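/- Let $\mathcal C$ be a category with finite limits in which every object $X$ has a parametrized list object $(L(X), r_0 : 1\to L(X), r_1 : X\times L(X)\to L(X))$; that is, for all $g:A\to B$ and $h:X\times B\to B$ there is a unique $f:A\times L(X)\to B$ with $f(a,r_0)=g(a)$ and $f(a,r_1(x,\ell))=h(x,f(a,\ell))$. Write $\varnothing$ for $r_0$ and $x::\ell$ for $r_1(x,\ell)$. Let $(N,0,s)$ be a parametrized natural numbers object of $\mathcal C$ (one exists, for instance $L(1)$): for all $g:A\to B$ and $h:A\times N\times B\to B$ there is a unique $f:A\times N\to B$ with $f(a,0)=g(a)$ and $f(a,sn)=h(a,n,f(a,n))$. The following arrows are defined by recursion: the predecessor $P:N\to N$ by $P0=0$, $P(sn)=n$; truncated subtraction by $m\dot- 0=m$, $m\dot- sn=P(m\dot- n)$; $\mathrm{len}_X:L(X)\to N$ by $\mathrm{len}(\varnothing)=0$, $\mathrm{len}(x::\ell)=s(\mathrm{len}(\ell))$; $\mathrm{tr}:L(X)\to L(X)$ by $\mathrm{tr}(\varnothing)=\varnothing$, $\mathrm{tr}(x::\ell)=\ell$; $\mathrm{tail}:N\times L(X)\to L(X)$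 by $\mathrm{tail}(0,\ell)=\ell$, $\mathrm{tail}(sn,\ell)=\mathrm{tr}(\mathrm{tail}(n,\ell))$; $\mathrm{zerothDef}:X\times L(X)\to X$ by $\mathrm{zerothDef}(x,\varnothing)=x$, $\mathrm{zerothDef}(x,y::\ell)=y$; and $L(f):L(X)\to L(Y)$, for $f:X\to Y$, by $L(f)(\varnothing)=\varnothing$, $L(f)(x::\ell)=f(x)::L(f)(\ell)$. Put $\mathrm{nthDef}(x,m,\ell)=\mathrm{zerothDef}(x,\mathrm{tail}(m,\ell))$. Let $E=\{(m,n)\in N\times N : m<n\}$ be the equalizer of $(m,n)\mapsto sm\dot- n$ and $(m,n)\mapsto 0$, and let $\pi_2^E:E\to N$ be $(m,n)\mapsto n$. Let $\Delta_{\pi_2^E}:\mathcal C/N\to\mathcal C/E$ be pullback along $\pi_2^E$, let $\Sigma_E:\mathcal C/E\to\mathcal C$ be the forgetful functor, and let $L_N:\mathcal C\to\mathcal C/N$ be the functor sending $X$ to $\mathrm{len}_X:L(X)\to N$ and $f$ to $L(f)$. Assume: (H1) for every object $X$, the commutative squares $\mathrm{len}_X\circ r_0=0\circ \mathrm{id}_1$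 and $\mathrm{len}_X\circ r_1=s\circ(\mathrm{len}_X\circ\pi_2)$ are pullback squares (of $\mathrm{len}_X$ along $0:1\to N$ and along $s:N\to N$, respectively); (H2) the coproduct $1\xrightarrow{0}N\xleftarrow{s}N$ is universal, i.e. its pullback along any arrow $A\to N$ is again a coproduct. By (H1), on $E\times_N L(X)=\{(m,\ell) : m<\mathrm{len}_X(\ell)\}$ the list $\ell$ decomposes uniquely as $\ell=x::\ell'$; let $\mathrm{def}_X:E\times_N L(X)\to X$ be the arrow $(m,\ell)\mapsto x$, and let $\mathrm{nth}_X:E\times_N L(X)\to X$ be $\mathrm{nth}_X(m,\ell)=\mathrm{nthDef}(\mathrm{def}_X(m,\ell),m,\ell)$. Then $L_N$ is right adjoint to $\Sigma_E\circ\Delta_{\pi_2^E}:\mathcal C/N\to\mathcal C$, by an adjunction whose counit at each $X$ is $\mathrm{nth}_X$. -/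

import Mathlib

open CategoryTheory Limits MonoidalCategory SemiCartesianMonoidalCategory CartesianMonoidalCategory

universe v u

namespace ListPoly

section Objects

variable {C : Type u} [Category.{v} C] [CartesianMonoidalCategory C]

/-- A (parametrized) natural numbers object `(N, 0, s)`: for all `g : A ⟶ B` and
`h : A × N × B ⟶ B` there is a unique `f : A × N ⟶ B` with
`f(a, 0) = g(a)` and `f(a, s n) = h(a, n, f(a, n))`. -/
structure NatObj (C : Type u) [Category.{v} C] [CartesianMonoidalCategory C] where
  N : C
  zero : 𝟙_ C ⟶ N
  succ : N ⟶ N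
  existsUnique_rec : ∀ {A B : C} (g : A ⟶ B) (h : A ⊗ (N ⊗ B) ⟶ B),
    ∃! f : A ⊗ N ⟶ B,
      lift (𝟙 A) (toUnit A ≫ zero) ≫ f = g ∧
      (A ◁ succ) ≫ f = lift (fst A N) (lift (snd A N) f) ≫ h

/-- A (parametrized) list object `(L(X), nil, cons)` on `X`: for all `g : A ⟶ B` and
`h : X × B ⟶ B` there is a unique `f : A × L(X) ⟶ B` with
`f(a, nil) = g(a)` and `f(a, x :: l) = h(x, f(a, l))`. -/
structure ListObj (X : C) where
  L : C
  nil : 𝟙_ C ⟶ L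
  cons : X ⊗ L ⟶ L
  existsUnique_fold : ∀ {A B : C} (g : A ⟶ B) (h : X ⊗ B ⟶ B),
    ∃! f : A ⊗ L ⟶ B,
      lift (𝟙 A) (toUnit A ≫ nil) ≫ f = g ∧
      (A ◁ cons) ≫ f =
        lift (snd A (X ⊗ L) ≫ fst X L) ((A ◁ snd X L) ≫ f) ≫ h

namespace NatObj

variable (N : NatObj C) {A B T : C}

/-- The arrow `A × N ⟶ B` defined by recursion from `g` and `h`. -/
noncomputable def recur (g : A ⟶ B) (h : A ⊗ (N.N ⊗ B) ⟶ B) : A ⊗ N.N ⟶ B :=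
  (N.existsUnique_rec g h).choose

lemma recur_zero (g : A ⟶ B) (h : A ⊗ (N.N ⊗ B) ⟶ B) (a : T ⟶ A) :
    lift a (toUnit T ≫ N.zero) ≫ N.recur g h = a ≫ g := by
  have e := (N.existsUnique_rec g h).choose_spec.1.1
  calc _ = a ≫ (lift (𝟙 A) (toUnit A ≫ N.zero) ≫ N.recur g h) := by
        simp [← Category.assoc, comp_lift]
    _ = _ := by rw [recur, e]

lemma recur_succ (g : A ⟶ B) (h : A ⊗ (N.N ⊗ B) ⟶ B) (a : T ⟶ A) (n : T ⟶ N.N) :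
    lift a (n ≫ N.succ) ≫ N.recur g h =
      lift a (lift n (lift a n ≫ N.recur g h)) ≫ h := by
  have e := (N.existsUnique_rec g h).choose_spec.1.2
  calc _ = lift a n ≫ (A ◁ N.succ) ≫ N.recur g h := by
        simp [← Category.assoc]
    _ = _ := by rw [recur, e]; simp [← Category.assoc, comp_lift]

lemma hom_ext_rec (g : A ⟶ B) (h : A ⊗ (N.N ⊗ B) ⟶ B) {f₁ f₂ : A ⊗ N.N ⟶ B}
    (z₁ : lift (𝟙 A) (toUnit A ≫ N.zero) ≫ f₁ = g)
    (s₁ : (A ◁ N.succ) ≫ f₁ = lift (fst A N.N) (lift (snd A N.N) f₁) ≫ h)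
    (z₂ : lift (𝟙 A) (toUnit A ≫ N.zero) ≫ f₂ = g)
    (s₂ : (A ◁ N.succ) ≫ f₂ = lift (fst A N.N) (lift (snd A N.N) f₂) ≫ h) : f₁ = f₂ :=
  (N.existsUnique_rec g h).unique ⟨z₁, s₁⟩ ⟨z₂, s₂⟩

/-- Predecessor: `P(0) = 0` and `P(s n) = n`. -/
noncomputable def pred : N.N ⟶ N.N :=
  lift (toUnit N.N) (𝟙 N.N) ≫
    N.recur (A := 𝟙_ C) N.zero (snd (𝟙_ C) (N.N ⊗ N.N) ≫ fst N.N N.N)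

@[simp]
lemma zero_pred : N.zero ≫ N.pred = N.zero := by
  have := N.recur_zero (A := 𝟙_ C) N.zero (snd (𝟙_ C) (N.N ⊗ N.N) ≫ fst N.N N.N) (𝟙 _)
  rw [Category.id_comp] at this
  rw [pred, ← Category.assoc, comp_lift]
  simpa using this

@[simp]
lemma succ_pred : N.succ ≫ N.pred = 𝟙 N.N := by
  have := N.recur_succ (A := 𝟙_ C) N.zero (snd (𝟙_ C) (N.N ⊗ N.N) ≫ fst N.N N.N)
    (toUnit N.N) (𝟙 _)
  rw [Category.id_comp] at this
  rw [pred, ← Category.assoc, comp_lift]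
  simpa using this

@[simp]
lemma succ_pred_assoc {Z : C} (f : N.N ⟶ Z) : N.succ ≫ N.pred ≫ f = f := by
  rw [← Category.assoc, succ_pred, Category.id_comp]

/-- Truncated subtraction `N × N ⟶ N`: `m ∸ 0 = m` and `m ∸ s n = P(m ∸ n)`. -/
noncomputable def monus : N.N ⊗ N.N ⟶ N.N :=
  N.recur (𝟙 N.N) (snd N.N (N.N ⊗ N.N) ≫ snd N.N N.N ≫ N.pred)

lemma monus_zero (m : T ⟶ N.N) : lift m (toUnit T ≫ N.zero) ≫ N.monus = m := by
  simp [monus, recur_zero]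

lemma monus_succ (m n : T ⟶ N.N) :
    lift m (n ≫ N.succ) ≫ N.monus = (lift m n ≫ N.monus) ≫ N.pred := by
  simp [monus, recur_succ]

/-- For terms `m n : T ⟶ N`, the relation `m < n`, that is, `s m ∸ n = 0`. -/
def Lt (m n : T ⟶ N.N) : Prop :=
  lift (m ≫ N.succ) n ≫ N.monus = toUnit T ≫ N.zero

/-- If `m < n` then `n = s (P n)`. -/
lemma Lt.succ_pred_eq {N : NatObj C} {m n : T ⟶ N.N} (h : N.Lt m n) :
    n ≫ N.pred ≫ N.succ = n := by
  -- `W(n, 0) = s (P n)` and `W(n, s k) = n`; then `W(n, s m ∸ n) = n` for all `m, n`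
  let W : N.N ⊗ N.N ⟶ N.N := N.recur (N.pred ≫ N.succ) (fst N.N (N.N ⊗ N.N))
  have W0 : ∀ {T : C} (n : T ⟶ N.N), lift n (toUnit T ≫ N.zero) ≫ W = n ≫ N.pred ≫ N.succ :=
    fun n => N.recur_zero _ _ n
  have W1 : ∀ {T : C} (n k : T ⟶ N.N), lift n (k ≫ N.succ) ≫ W = n := by
    intro T n k
    simp [W, recur_succ]
  have WS : (N.succ ▷ N.N) ≫ W = fst _ _ ≫ N.succ := by
    refine N.hom_ext_rec (A := N.N) N.succ (fst N.N (N.N ⊗ N.N) ≫ N.succ) ?_ ?_ ?_ ?_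
    · rw [← Category.assoc, lift_whiskerRight, W0]; simp
    · have e : (N.N ◁ N.succ) ≫ (N.succ ▷ N.N) = lift (fst N.N N.N ≫ N.succ) (snd _ _ ≫ N.succ) := by
        ext <;> simp
      rw [← Category.assoc, e, W1]; simp
    · simp
    · simp
  have WS1 : ∀ {T : C} (n k : T ⟶ N.N), lift (n ≫ N.succ) k ≫ W = n ≫ N.succ := by
    intro T n k
    rw [← lift_whiskerRight, Category.assoc, WS]; simp
  have key : lift (snd N.N N.N) (lift (fst _ _ ≫ N.succ) (snd _ _) ≫ N.monus) ≫ W =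
      snd N.N N.N := by
    refine N.hom_ext_rec (A := N.N) (toUnit _ ≫ N.zero)
      (snd N.N (N.N ⊗ N.N) ≫ fst _ _ ≫ N.succ) ?_ ?_ ?_ ?_
    · rw [← Category.assoc, comp_lift, ← Category.assoc, comp_lift]
      simp only [lift_snd, lift_fst_assoc, Category.id_comp]
      rw [monus_zero]
      have := W1 (toUnit N.N ≫ N.zero) (𝟙 N.N)
      simpa using this
    · rw [← Category.assoc, comp_lift]
      simp only [whiskerLeft_snd]
      rw [WS1]; simp
    · simp
    · simp
  have k2 := congrArg (fun t => lift m n ≫ t) key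
  simp only [← Category.assoc, comp_lift, lift_snd] at k2
  simp only [lift_fst] at k2
  rw [show lift (m ≫ N.succ) n ≫ N.monus = toUnit T ≫ N.zero from h, W0] at k2
  exact k2

end NatObj

namespace ListObj

variable {X : C} (l : ListObj X) {A B T : C}

/-- The arrow `A × L(X) ⟶ B` defined by list recursion from `g` and `h`. -/
noncomputable def fold (g : A ⟶ B) (h : X ⊗ B ⟶ B) : A ⊗ l.L ⟶ B :=
  (l.existsUnique_fold g h).choose

lemma fold_nil (g : A ⟶ B) (h : X ⊗ B ⟶ B) (a : T ⟶ A) :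
    lift a (toUnit T ≫ l.nil) ≫ l.fold g h = a ≫ g := by
  have e := (l.existsUnique_fold g h).choose_spec.1.1
  calc _ = a ≫ (lift (𝟙 A) (toUnit A ≫ l.nil) ≫ l.fold g h) := by
        simp [← Category.assoc, comp_lift]
    _ = _ := by rw [fold, e]

lemma fold_cons (g : A ⟶ B) (h : X ⊗ B ⟶ B) (a : T ⟶ A) (x : T ⟶ X) (t : T ⟶ l.L) :
    lift a (lift x t ≫ l.cons) ≫ l.fold g h = lift x (lift a t ≫ l.fold g h) ≫ h := by
  have e := (l.existsUnique_fold g h).choose_spec.1.2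
  calc _ = lift a (lift x t) ≫ (A ◁ l.cons) ≫ l.fold g h := by
        simp [← Category.assoc]
    _ = _ := by rw [fold, e]; simp [← Category.assoc, comp_lift]

lemma hom_ext_fold (g : A ⟶ B) (h : X ⊗ B ⟶ B) {f₁ f₂ : A ⊗ l.L ⟶ B}
    (z₁ : lift (𝟙 A) (toUnit A ≫ l.nil) ≫ f₁ = g)
    (s₁ : (A ◁ l.cons) ≫ f₁ =
      lift (snd A (X ⊗ l.L) ≫ fst X l.L) ((A ◁ snd X l.L) ≫ f₁) ≫ h)
    (z₂ : lift (𝟙 A) (toUnit A ≫ l.nil) ≫ f₂ = g)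
    (s₂ : (A ◁ l.cons) ≫ f₂ =
      lift (snd A (X ⊗ l.L) ≫ fst X l.L) ((A ◁ snd X l.L) ≫ f₂) ≫ h) : f₁ = f₂ :=
  (l.existsUnique_fold g h).unique ⟨z₁, s₁⟩ ⟨z₂, s₂⟩

/-- List recursion without parameter. -/
noncomputable def fold₁ (g : 𝟙_ C ⟶ B) (h : X ⊗ B ⟶ B) : l.L ⟶ B :=
  lift (toUnit l.L) (𝟙 l.L) ≫ l.fold g h

@[simp]
lemma nil_fold₁ (g : 𝟙_ C ⟶ B) (h : X ⊗ B ⟶ B) : l.nil ≫ l.fold₁ g h = g := by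
  have := l.fold_nil g h (𝟙 _)
  rw [fold₁, ← Category.assoc, comp_lift]
  simpa using this

@[simp]
lemma cons_fold₁ (g : 𝟙_ C ⟶ B) (h : X ⊗ B ⟶ B) :
    l.cons ≫ l.fold₁ g h = (X ◁ l.fold₁ g h) ≫ h := by
  have := l.fold_cons g h (toUnit _) (fst X l.L) (snd X l.L)
  simp only [lift_fst_snd, Category.id_comp] at this
  rw [fold₁, ← Category.assoc, comp_lift]
  simp only [comp_toUnit, Category.comp_id]
  rw [this]
  have e : lift (toUnit (X ⊗ l.L)) (snd X l.L) =
      snd X l.L ≫ lift (toUnit l.L) (𝟙 l.L) := by simp [comp_lift]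
  congr 1
  ext
  · simp
  · rw [lift_snd, whiskerLeft_snd, e, Category.assoc]

@[simp]
lemma nil_fold₁_assoc {Z : C} (g : 𝟙_ C ⟶ B) (h : X ⊗ B ⟶ B) (k : B ⟶ Z) :
    l.nil ≫ l.fold₁ g h ≫ k = g ≫ k := by
  rw [← Category.assoc, nil_fold₁]

@[simp]
lemma cons_fold₁_assoc {Z : C} (g : 𝟙_ C ⟶ B) (h : X ⊗ B ⟶ B) (k : B ⟶ Z) :
    l.cons ≫ l.fold₁ g h ≫ k = (X ◁ l.fold₁ g h) ≫ h ≫ k := by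
  rw [← Category.assoc, cons_fold₁, Category.assoc]

lemma hom_ext_fold₁ (g : 𝟙_ C ⟶ B) (h : X ⊗ B ⟶ B) {f₁ f₂ : l.L ⟶ B}
    (z₁ : l.nil ≫ f₁ = g) (s₁ : l.cons ≫ f₁ = (X ◁ f₁) ≫ h)
    (z₂ : l.nil ≫ f₂ = g) (s₂ : l.cons ≫ f₂ = (X ◁ f₂) ≫ h) : f₁ = f₂ := by
  have aux : ∀ f : l.L ⟶ B, l.nil ≫ f = g → l.cons ≫ f = (X ◁ f) ≫ h →
      snd (𝟙_ C) l.L ≫ f = l.fold g h := by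
    intro f z s
    refine (l.existsUnique_fold g h).choose_spec.2 _ ⟨?_, ?_⟩
    · simpa [toUnit_unique (toUnit (𝟙_ C)) (𝟙 _)] using z
    · have e : (𝟙_ C ◁ snd X l.L) ≫ snd (𝟙_ C) l.L ≫ f =
          snd (𝟙_ C) (X ⊗ l.L) ≫ snd X l.L ≫ f := by
        rw [← Category.assoc, whiskerLeft_snd, Category.assoc]
      rw [e, ← Category.assoc, whiskerLeft_snd, Category.assoc, s, ← Category.assoc]
      congr 1
      apply CartesianMonoidalCategory.hom_ext
      · rw [Category.assoc, whiskerLeft_fst, lift_fst]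
      · rw [Category.assoc, whiskerLeft_snd, lift_snd]
  have := (aux f₁ z₁ s₁).trans (aux f₂ z₂ s₂).symm
  have := congrArg (fun t => lift (toUnit l.L) (𝟙 l.L) ≫ t) this
  simpa using this

/-- The truncation arrow paired with the identity, `t ↦ (t, tr t)`. -/
noncomputable def trAux : l.L ⟶ l.L ⊗ l.L :=
  l.fold₁ (lift l.nil l.nil) (lift ((X ◁ fst l.L l.L) ≫ l.cons) (snd _ _ ≫ fst l.L l.L))

lemma trAux_fst : l.trAux ≫ fst _ _ = 𝟙 _ := by
  refine l.hom_ext_fold₁ l.nil l.cons ?_ ?_ ?_ ?_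
  · simp [trAux]
  · simp [trAux, ← Category.assoc]
  · simp
  · simp

/-- Truncation: `tr(nil) = nil` and `tr(x :: t) = t`. -/
noncomputable def tr : l.L ⟶ l.L := l.trAux ≫ snd _ _

@[simp]
lemma nil_tr : l.nil ≫ l.tr = l.nil := by
  simp [tr, trAux]

@[simp]
lemma cons_tr : l.cons ≫ l.tr = snd X l.L := by
  have h : l.cons ≫ l.trAux = _ := l.cons_fold₁ _ _
  rw [tr, ← Category.assoc, h]
  have e := l.trAux_fst
  rw [trAux] at e
  simp [e]

/-- The zeroth element with default: `zerothDef(x, nil) = x`, `zerothDef(x, y :: t) = y`. -/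
noncomputable def zerothDef : X ⊗ l.L ⟶ X :=
  l.fold (𝟙 X) (fst X X)

/-- Length: `len(nil) = 0` and `len(x :: t) = s (len t)`. -/
noncomputable def len (N : NatObj C) : l.L ⟶ N.N :=
  l.fold₁ N.zero (snd X N.N ≫ N.succ)

/-- Iterated truncation: `tail(0, t) = t` and `tail(s n, t) = tr (tail(n, t))`. -/
noncomputable def tail (N : NatObj C) : N.N ⊗ l.L ⟶ l.L :=
  lift (snd N.N l.L) (fst N.N l.L) ≫
    N.recur (𝟙 l.L) (snd l.L (N.N ⊗ l.L) ≫ snd N.N l.L ≫ l.tr)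

/-- The `n`-th element with default: `nthDef(x, n, t) = zerothDef(x, tail(n, t))`. -/
noncomputable def nthDef (N : NatObj C) : X ⊗ (N.N ⊗ l.L) ⟶ X :=
  (X ◁ l.tail N) ≫ l.zerothDef

/-- The action of the list construction on an arrow: `L(f)(nil) = nil` and
`L(f)(x :: t) = f(x) :: L(f)(t)`. -/
noncomputable def map {Y : C} (l : ListObj X) (l' : ListObj Y) (f : X ⟶ Y) : l.L ⟶ l'.L :=
  l.fold₁ l'.nil ((f ▷ l'.L) ≫ l'.cons)

lemma map_id : l.map l (𝟙 X) = 𝟙 l.L := by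
  refine l.hom_ext_fold₁ l.nil l.cons ?_ ?_ ?_ ?_ <;> simp [map]

lemma map_comp {Y Z : C} (l' : ListObj Y) (l'' : ListObj Z) (f : X ⟶ Y) (g : Y ⟶ Z) :
    l.map l'' (f ≫ g) = l.map l' f ≫ l'.map l'' g := by
  refine l.hom_ext_fold₁ l''.nil (((f ≫ g) ▷ l''.L) ≫ l''.cons) ?_ ?_ ?_ ?_
  · simp [map]
  · simp [map]
  · simp [map]
  · simp [map, whisker_exchange_assoc]

lemma map_len (N : NatObj C) {Y : C} (l' : ListObj Y) (f : X ⟶ Y) :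
    l.map l' f ≫ l'.len N = l.len N := by
  refine l.hom_ext_fold₁ N.zero (snd X N.N ≫ N.succ) ?_ ?_ ?_ ?_ <;> simp [map, len]

/-- A list object on the terminal object is a natural numbers object. -/
noncomputable def natObj (l : ListObj (𝟙_ C)) : NatObj C where
  N := l.L
  zero := l.nil
  succ := lift (toUnit l.L) (𝟙 l.L) ≫ l.cons
  existsUnique_rec := by
    intro A B g h
    have hc : l.cons = snd _ _ ≫ lift (toUnit l.L) (𝟙 l.L) ≫ l.cons := by
      conv_lhs => rw [← Category.id_comp l.cons]
      rw [← Category.assoc]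
      congr 1
      apply CartesianMonoidalCategory.hom_ext
      · exact toUnit_unique _ _
      · simp
    set s : l.L ⟶ l.L := lift (toUnit l.L) (𝟙 l.L) ≫ l.cons with hs
    -- list recursion with step `snd ≫ k` is iteration of `k`
    have uniq : ∀ {D : C} (k : D ⟶ D) (f₁ f₂ : A ⊗ l.L ⟶ D),
        lift (𝟙 A) (toUnit A ≫ l.nil) ≫ f₁ = lift (𝟙 A) (toUnit A ≫ l.nil) ≫ f₂ →
        (A ◁ s) ≫ f₁ = f₁ ≫ k → (A ◁ s) ≫ f₂ = f₂ ≫ k → f₁ = f₂ := by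
      intro D k f₁ f₂ h0 h1 h2
      have conv : ∀ f : A ⊗ l.L ⟶ D, (A ◁ s) ≫ f = f ≫ k → (A ◁ l.cons) ≫ f =
          lift (snd A (𝟙_ C ⊗ l.L) ≫ fst _ l.L) ((A ◁ snd _ l.L) ≫ f) ≫ snd _ _ ≫ k := by
        intro f hf
        rw [hc, MonoidalCategory.whiskerLeft_comp, Category.assoc, hf, ← Category.assoc,
          ← Category.assoc, lift_snd]
      exact l.hom_ext_fold _ (snd _ _ ≫ k) h0 (conv f₁ h1) rfl (conv f₂ h2)
    let k : A ⊗ (l.L ⊗ B) ⟶ A ⊗ (l.L ⊗ B) :=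
      lift (fst _ _) (lift (snd _ _ ≫ fst _ _ ≫ s) h)
    let F : A ⊗ l.L ⟶ A ⊗ (l.L ⊗ B) :=
      l.fold (lift (𝟙 A) (lift (toUnit A ≫ l.nil) g)) (snd _ _ ≫ k)
    have F0 : lift (𝟙 A) (toUnit A ≫ l.nil) ≫ F =
        lift (𝟙 A) (lift (toUnit A ≫ l.nil) g) := by
      have := l.fold_nil (lift (𝟙 A) (lift (toUnit A ≫ l.nil) g)) (snd _ _ ≫ k) (𝟙 A)
      rwa [Category.id_comp] at this
    have F1 : (A ◁ s) ≫ F = F ≫ k := by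
      have := l.fold_cons (lift (𝟙 A) (lift (toUnit A ≫ l.nil) g)) (snd _ _ ≫ k)
        (fst A l.L) (toUnit _) (snd A l.L)
      rw [← Category.assoc, lift_snd, lift_fst_snd, Category.id_comp] at this
      rw [← this]
      congr 1
      ext
      · simp
      · have e : lift (toUnit (A ⊗ l.L)) (snd A l.L) =
            snd A l.L ≫ lift (toUnit l.L) (𝟙 l.L) := by simp [comp_lift]
        rw [whiskerLeft_snd, lift_snd, hs, e, Category.assoc]
    have Ffst : F ≫ fst _ _ = fst _ _ := by
      refine uniq (𝟙 A) _ _ ?_ ?_ ?_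
      · rw [← Category.assoc, F0]; simp
      · rw [← Category.assoc, F1]; simp [k]
      · simp
    have Fsnd : F ≫ snd _ _ ≫ fst _ _ = snd _ _ := by
      refine uniq s _ _ ?_ ?_ ?_
      · rw [← Category.assoc, F0]; simp
      · rw [← Category.assoc, F1]; simp [k]
      · simp
    have Feq : F = lift (fst A l.L) (lift (snd A l.L) (F ≫ snd _ _ ≫ snd _ _)) := by
      ext
      · simpa using Ffst
      · simpa using Fsnd
      · simp
    refine ⟨F ≫ snd _ _ ≫ snd _ _, ⟨?_, ?_⟩, ?_⟩
    · rw [← Category.assoc, F0]; simp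
    · rw [← Feq, ← Category.assoc, F1]; simp [k]
    · rintro f ⟨f0, f1⟩
      have : lift (fst A l.L) (lift (snd A l.L) f) = F := by
        refine uniq k _ _ ?_ ?_ F1
        · rw [F0, comp_lift, comp_lift, f0]; simp
        · rw [comp_lift, comp_lift, f1]; simp [k, comp_lift]
      rw [← this]; simp

end ListObj

end Objects

section Functors

variable {C : Type u} [Category.{v} C] [CartesianMonoidalCategory C] [HasFiniteLimits C]

namespace NatObj

variable (N : NatObj C)

/-- The object `E = {m : N, n : N | m < n}`, the equalizer of `(m, n) ↦ s m ∸ n` and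
`(m, n) ↦ 0`. -/
noncomputable def E : C :=
  equalizer ((N.succ ▷ N.N) ≫ N.monus) (toUnit (N.N ⊗ N.N) ≫ N.zero)

/-- The inclusion of `E` into `N × N`. -/
noncomputable def ιE : N.E ⟶ N.N ⊗ N.N :=
  equalizer.ι ((N.succ ▷ N.N) ≫ N.monus) (toUnit (N.N ⊗ N.N) ≫ N.zero)

/-- The map `E ⟶ N` sending `(m, n)` to `n`. -/
noncomputable def π₂E : N.E ⟶ N.N := N.ιE ≫ snd N.N N.N

lemma lt_E : N.Lt (N.ιE ≫ fst N.N N.N) N.π₂E := by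
  have h : N.ιE ≫ (N.succ ▷ N.N) ≫ N.monus = N.ιE ≫ toUnit (N.N ⊗ N.N) ≫ N.zero :=
    equalizer.condition _ _
  have e : N.ιE ≫ (N.succ ▷ N.N) = lift ((N.ιE ≫ fst N.N N.N) ≫ N.succ) N.π₂E := by
    ext <;> simp [π₂E]
  rw [Lt, ← e, Category.assoc, h]
  simp

/-- The coproduct `1 ⟶ N ⟵ N` given by `0` and `s` is universal: its pullback along any
arrow is a coproduct. -/
def UniversalCoproduct : Prop :=
  IsUniversalColimit (BinaryCofan.mk N.zero N.succ)

end NatObj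

variable (L : ∀ X : C, ListObj X) (N : NatObj C)

/-- For every `X`, the two squares comparing `nil` and `cons` with `0` and `s` via the length
are pullbacks. -/
def LengthSquaresPullback : Prop :=
  ∀ X : C,
    IsPullback (L X).nil (toUnit (𝟙_ C)) ((L X).len N) N.zero ∧
    IsPullback (L X).cons (snd X (L X).L ≫ (L X).len N) ((L X).len N) N.succ

/-- The functor `L_N : C ⥤ C/N` sending `X` to `len : L(X) ⟶ N`. -/
noncomputable def listOver : C ⥤ Over N.N where
  obj X := Over.mk ((L X).len N)
  map {X Y} f := Over.homMk ((L X).map (L Y) f) ((L X).map_len N (L Y) f)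
  map_id X := by ext; exact (L X).map_id
  map_comp {X Y Z} f g := by ext; exact (L X).map_comp (L Y) (L Z) f g

/-- The functor `Σ_E ∘ Δ_{π₂E} : C/N ⥤ C`, sending `A ⟶ N` to `E ×_N A`. -/
noncomputable def sigmaDelta : Over N.N ⥤ C :=
  Over.pullback N.π₂E ⋙ Over.forget N.E

/-- The object `E ×_N L(X) = {m : N, t : L(X) | m < len t}`. -/
noncomputable abbrev EList (X : C) : C :=
  pullback ((L X).len N) N.π₂E

/-- The term `m : N` in the context `(m : N, t : L(X) | m < len t)`. -/
noncomputable def idx (X : C) : EList L N X ⟶ N.N :=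
  pullback.snd ((L X).len N) N.π₂E ≫ N.ιE ≫ fst N.N N.N

/-- The term `t : L(X)` in the context `(m : N, t : L(X) | m < len t)`. -/
noncomputable def lst (X : C) :
    EList L N X ⟶ (L X).L :=
  pullback.fst ((L X).len N) N.π₂E

variable {L N}

lemma lt_len (X : C) : N.Lt (idx L N X) (lst L N X ≫ (L X).len N) := by
  have h := congrArg (fun t => pullback.snd ((L X).len N) N.π₂E ≫ t) N.lt_E
  rw [NatObj.Lt, idx, lst, pullback.condition]
  simpa [← Category.assoc, comp_lift] using h

/-- The decomposition `t = x :: t₁` of the list `t` in the context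
`(m : N, t : L(X) | m < len t)`, which exists because the right-hand length square is a
pullback. -/
noncomputable def decomp (h₁ : LengthSquaresPullback L N) (X : C) :
    EList L N X ⟶ X ⊗ (L X).L :=
  (h₁ X).2.lift (lst L N X) ((lst L N X ≫ (L X).len N) ≫ N.pred)
    (by simpa using (lt_len (L := L) (N := N) X).succ_pred_eq.symm)

/-- The default term `def_X : X` in the context `(m : N, t : L(X) | m < len t)`, the leading
element of `t`. -/
noncomputable def dflt (h₁ : LengthSquaresPullback L N) (X : C) : EList L N X ⟶ X :=
  decomp h₁ X ≫ fst X (L X).L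

/-- The arrow `nth_X : E ×_N L(X) ⟶ X`, given by `nth(m, t) = nthDef(def_X, m, t)`. -/
noncomputable def nth (h₁ : LengthSquaresPullback L N) (X : C) : EList L N X ⟶ X :=
  lift (dflt h₁ X) (lift (idx L N X) (lst L N X)) ≫ (L X).nthDef N

end Functors

end ListPoly

/-!
For an arrow `p : A ⟶ N`, the object `E ×_N A` is `{(m, a) : m < p a}`. The adjunction says that
arrows `f : A ⟶ L(X)` of length `p` correspond, by `f ↦ nth (m, f a)`, to families
`g : {(m, a) : m < p a} ⟶ X`: a list is the same thing as its length and its elements.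

The category need not be cartesian closed, so every recursion and induction has to be
carried out with fixed parameters. By universality of the coproduct `1 + N`, the object `A` is the
coproduct of the part where `p a = 0` and the part where `p a = s q`. On the first part the only
list of length `p` is empty. On the second part everything is indexed in reverse, by `q ∸ k`, which
is below `s q` for all `k`; this makes the partial data total.

* Existence (`elements_surjective`): tabulate `k ↦ g (q ∸ k, a)` for `k < s q`. Truncating a table
  `m` times lowers its bound by `m` (`ListObj.drop_tabulate`), and `q ∸ (q ∸ m) = m` for `m ≤ q`
  (`NatObj.sub_sub_of_le`) gives back `g (m, a)`. The arithmetic rests on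
  `m + (n ∸ m) = n + (m ∸ n)`, which needs the double induction `NatObj.hom_ext_double`.
* Uniqueness (`elements_injective`): the truncations `tail (s q ∸ k, t)` of a list `t` of length
  `s q` satisfy a recursion in `k` that involves only the elements of index `q ∸ k`, and reach `t`
  at `k = s q` (`ListObj.eq_of_hd_drop_eq`).

Naturality of `nth` (`counitApp_naturality`) turns these bijections into the adjunction.

Arrows are manipulated as operations on generalized elements `T ⟶ N`, `T ⟶ L(X)`, with simp lemmas
for substitution along `U ⟶ T`; identities between operations are proved at the generic element and
then substituted.
-/

namespace ListPoly

variable {C : Type u} [Category.{v} C] [CartesianMonoidalCategory C]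

/-! ### Natural numbers, on generalized elements -/

namespace NatObj

variable (N : NatObj C) {A B T U : C}

/-- The generalized element `0 : N` at stage `T`. -/
def Z : T ⟶ N.N := toUnit T ≫ N.zero

/-- The successor of a generalized element of `N`. -/
def S (n : T ⟶ N.N) : T ⟶ N.N := n ≫ N.succ

/-- The predecessor of a generalized element of `N`. -/
noncomputable def P (n : T ⟶ N.N) : T ⟶ N.N := n ≫ N.pred

/-- Truncated subtraction of generalized elements of `N`. -/
noncomputable def sub (m n : T ⟶ N.N) : T ⟶ N.N := lift m n ≫ N.monus

/-- Addition of generalized elements of `N`, by recursion on the second argument. -/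
noncomputable def add (m n : T ⟶ N.N) : T ⟶ N.N :=
  lift m n ≫ N.recur (𝟙 N.N) (snd _ _ ≫ snd _ _ ≫ N.succ)

/-- Definition by cases on a generalized element of `N`: the value is `b₀` at `0` and `b₁` at
a successor. -/
noncomputable def cond (n : T ⟶ N.N) (b₀ b₁ : T ⟶ B) : T ⟶ B :=
  lift (lift b₀ b₁) n ≫ N.recur (fst B B) (fst _ _ ≫ snd B B)

variable {N}

@[simp] lemma comp_Z (t : U ⟶ T) : t ≫ (N.Z : T ⟶ N.N) = N.Z := by simp [Z]

@[simp] lemma comp_S (t : U ⟶ T) (n : T ⟶ N.N) : t ≫ N.S n = N.S (t ≫ n) := by simp [S]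

@[simp] lemma comp_P (t : U ⟶ T) (n : T ⟶ N.N) : t ≫ N.P n = N.P (t ≫ n) := by simp [P]

@[simp] lemma comp_sub (t : U ⟶ T) (m n : T ⟶ N.N) :
    t ≫ N.sub m n = N.sub (t ≫ m) (t ≫ n) := by
  simp [sub, ← Category.assoc, comp_lift]

@[simp] lemma comp_add (t : U ⟶ T) (m n : T ⟶ N.N) :
    t ≫ N.add m n = N.add (t ≫ m) (t ≫ n) := by
  simp [add, ← Category.assoc, comp_lift]

@[simp] lemma comp_cond (t : U ⟶ T) (n : T ⟶ N.N) (b₀ b₁ : T ⟶ B) :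
    t ≫ N.cond n b₀ b₁ = N.cond (t ≫ n) (t ≫ b₀) (t ≫ b₁) := by
  simp [cond, ← Category.assoc, comp_lift]

@[simp] lemma P_Z : N.P (N.Z : T ⟶ N.N) = N.Z := by simp [P, Z]

@[simp] lemma P_S (n : T ⟶ N.N) : N.P (N.S n) = n := by simp [P, S]

@[simp] lemma sub_Z (m : T ⟶ N.N) : N.sub m N.Z = m := N.monus_zero m

@[simp] lemma sub_S (m n : T ⟶ N.N) : N.sub m (N.S n) = N.P (N.sub m n) := N.monus_succ m n

@[simp] lemma add_Z (m : T ⟶ N.N) : N.add m N.Z = m := by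
  simp [add, Z, recur_zero]

@[simp] lemma add_S (m n : T ⟶ N.N) : N.add m (N.S n) = N.S (N.add m n) := by
  simp [add, S, recur_succ]

@[simp] lemma cond_Z (b₀ b₁ : T ⟶ B) : N.cond N.Z b₀ b₁ = b₀ := by
  simp [cond, Z, recur_zero]

@[simp] lemma cond_S (n : T ⟶ N.N) (b₀ b₁ : T ⟶ B) : N.cond (N.S n) b₀ b₁ = b₁ := by
  simp [cond, S, recur_succ]

/-- Induction: two arrows out of `A × N` agree if they agree at `0` and satisfy the same
recursion at successors. -/
lemma hom_ext_ind (h : A ⊗ (N.N ⊗ B) ⟶ B) {f₁ f₂ : A ⊗ N.N ⟶ B}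
    (z : lift (𝟙 A) N.Z ≫ f₁ = lift (𝟙 A) N.Z ≫ f₂)
    (s₁ : lift (fst A N.N) (N.S (snd A N.N)) ≫ f₁ = lift (fst _ _) (lift (snd _ _) f₁) ≫ h)
    (s₂ : lift (fst A N.N) (N.S (snd A N.N)) ≫ f₂ = lift (fst _ _) (lift (snd _ _) f₂) ≫ h) :
    f₁ = f₂ := by
  have e : (A ◁ N.succ) = lift (fst A N.N) (N.S (snd A N.N)) := by ext <;> simp [S]
  exact N.hom_ext_rec _ h z (e ▸ s₁) rfl (e ▸ s₂)

/-- Case distinction: two arrows out of `A × N` agree if they agree at `0` and at successors. -/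
lemma hom_ext_cases {f₁ f₂ : A ⊗ N.N ⟶ B}
    (z : lift (𝟙 A) N.Z ≫ f₁ = lift (𝟙 A) N.Z ≫ f₂)
    (s : lift (fst A N.N) (N.S (snd A N.N)) ≫ f₁ = lift (fst A N.N) (N.S (snd A N.N)) ≫ f₂) :
    f₁ = f₂ := by
  have e (f : A ⊗ N.N ⟶ B) : lift (fst A N.N) (lift (snd A N.N) f) ≫
      lift (fst _ _) (snd _ _ ≫ fst _ _) = 𝟙 _ := by ext <;> simp
  refine N.hom_ext_ind (lift (fst _ _) (snd _ _ ≫ fst _ _) ≫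
    lift (fst A N.N) (N.S (snd A N.N)) ≫ f₁) z ?_ ?_
  · rw [← Category.assoc, e, Category.id_comp]
  · rw [← Category.assoc, e, Category.id_comp, s]

@[simp] lemma S_sub_S (m n : T ⟶ N.N) : N.sub (N.S m) (N.S n) = N.sub m n := by
  have key : N.sub (N.S (fst N.N N.N)) (N.S (snd _ _)) = N.sub (fst N.N N.N) (snd _ _) :=
    N.hom_ext_ind (N.P (snd _ _ ≫ snd _ _)) (by simp) (by simp) (by simp)
  simpa [-sub_S] using congrArg (lift m n ≫ ·) key

@[simp] lemma Z_sub (n : T ⟶ N.N) : N.sub N.Z n = N.Z := by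
  have key : N.sub (N.Z) (snd N.N N.N) = N.Z :=
    N.hom_ext_ind (N.P (snd _ _ ≫ snd _ _)) (by simp) (by simp [P]) (by simp)
  simpa using congrArg (lift n n ≫ ·) key

@[simp] lemma sub_self (n : T ⟶ N.N) : N.sub n n = N.Z := by
  have key : N.sub (snd N.N N.N) (snd N.N N.N) = N.Z :=
    N.hom_ext_ind (snd _ _ ≫ snd _ _) (by simp) (by simp [-sub_S]) (by simp)
  simpa using congrArg (lift n n ≫ ·) key

lemma P_sub (m n : T ⟶ N.N) : N.sub (N.P m) n = N.P (N.sub m n) := by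
  have key : N.sub (N.P (fst N.N N.N)) (snd _ _) = N.P (N.sub (fst N.N N.N) (snd _ _)) :=
    N.hom_ext_ind (N.P (snd _ _ ≫ snd _ _)) (by simp) (by simp) (by simp)
  simpa using congrArg (lift m n ≫ ·) key

@[simp] lemma sub_sub_self (n k : T ⟶ N.N) : N.sub (N.sub n k) n = N.Z := by
  have key : N.sub (N.sub (fst N.N N.N) (snd _ _)) (fst _ _) = N.Z :=
    N.hom_ext_ind (N.P (snd _ _ ≫ snd _ _)) (by simp) (by simp [P_sub]) (by simp)
  simpa using congrArg (lift n k ≫ ·) key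

lemma S_add (m n : T ⟶ N.N) : N.add (N.S m) n = N.S (N.add m n) := by
  have key : N.add (N.S (fst N.N N.N)) (snd _ _) = N.S (N.add (fst N.N N.N) (snd _ _)) :=
    N.hom_ext_ind (N.S (snd _ _ ≫ snd _ _)) (by simp) (by simp) (by simp)
  simpa using congrArg (lift m n ≫ ·) key

@[simp] lemma Z_add (n : T ⟶ N.N) : N.add N.Z n = n := by
  have key : N.add N.Z (snd N.N N.N) = snd _ _ :=
    N.hom_ext_ind (N.S (snd _ _ ≫ snd _ _)) (by simp) (by simp) (by simp)
  simpa using congrArg (lift n n ≫ ·) key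

@[simp] lemma add_sub_cancel_right (m n : T ⟶ N.N) : N.sub (N.add m n) n = m := by
  have key : N.sub (N.add (fst N.N N.N) (snd _ _)) (snd _ _) = fst N.N N.N :=
    N.hom_ext_ind (snd _ _ ≫ snd _ _) (by simp) (by simp [-sub_S]) (by simp)
  simpa using congrArg (lift m n ≫ ·) key

@[simp] lemma add_sub_cancel_left (m n : T ⟶ N.N) : N.sub (N.add m n) m = n := by
  have key : N.sub (N.add (snd N.N N.N) (fst _ _)) (snd _ _) = fst N.N N.N :=
    N.hom_ext_ind (snd _ _ ≫ snd _ _) (by simp) (by simp [-sub_S, S_add]) (by simp)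
  simpa using congrArg (lift n m ≫ ·) key

/-- Double induction. Along the diagonal through `(m, q)`, the values
`f (m ∸ (m ∸ j), q ∸ (m ∸ j))` satisfy a recursion in `j` that depends only on the two edges
and on `h`; it starts at `f (0, q ∸ m)` and reaches `f (m, q)` at `j = m`. -/
lemma hom_ext_double {f₁ f₂ : N.N ⊗ N.N ⟶ B} (h : B ⟶ B)
    (z : lift N.Z (𝟙 _) ≫ f₁ = lift N.Z (𝟙 _) ≫ f₂)
    (z' : lift (𝟙 _) N.Z ≫ f₁ = lift (𝟙 _) N.Z ≫ f₂)
    (s₁ : lift (N.S (fst _ _)) (N.S (snd _ _)) ≫ f₁ = f₁ ≫ h)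
    (s₂ : lift (N.S (fst _ _)) (N.S (snd _ _)) ≫ f₂ = f₂ ≫ h) : f₁ = f₂ := by
  -- `f` is determined by its edges and by its value at the predecessors
  have split {T : C} (u w : T ⟶ N.N) (f : N.N ⊗ N.N ⟶ B)
      (s : lift (N.S (fst _ _)) (N.S (snd _ _)) ≫ f = f ≫ h) :
      lift u w ≫ f = N.cond u (lift N.Z w ≫ f)
        (N.cond w (lift u N.Z ≫ f) (lift (N.P u) (N.P w) ≫ f ≫ h)) := by
    have key' : lift (N.S (fst _ _)) (snd _ _) ≫ f =
        N.cond (snd _ _) (lift (N.S (fst _ _)) N.Z ≫ f) (lift (fst _ _) (N.P (snd _ _)) ≫ f ≫ h) :=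
      N.hom_ext_cases (by simp [comp_lift_assoc]) (by simp [comp_lift_assoc, ← s])
    have key : lift (snd _ _) (fst _ _) ≫ f = N.cond (snd _ _) (lift N.Z (fst _ _) ≫ f)
        (N.cond (fst N.N N.N) (lift (snd _ _) N.Z ≫ f)
          (lift (N.P (snd _ _)) (N.P (fst _ _)) ≫ f ≫ h)) := by
      refine N.hom_ext_cases (by simp [comp_lift_assoc]) ?_
      simpa [comp_lift_assoc] using congrArg (lift (snd _ _) (fst _ _) ≫ ·) key'
    simpa [comp_lift_assoc] using congrArg (lift w u ≫ ·) key
  -- with `a = m ∸ j`, so that `P a = m ∸ s j`: the value at `s j` in terms of the one at `j`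
  have step {T : C} (a m q : T ⟶ N.N) (f : N.N ⊗ N.N ⟶ B)
      (s : lift (N.S (fst _ _)) (N.S (snd _ _)) ≫ f = f ≫ h) :
      lift (N.sub m (N.P a)) (N.sub q (N.P a)) ≫ f =
        N.cond a (lift (N.sub m a) (N.sub q a) ≫ f)
          (N.cond (N.sub m (N.P a)) (lift N.Z (N.sub q (N.P a)) ≫ f)
            (N.cond (N.sub q (N.P a)) (lift (N.sub m (N.P a)) N.Z ≫ f)
              (lift (N.sub m a) (N.sub q a) ≫ f ≫ h))) := by
    let m' : T ⊗ N.N ⟶ N.N := fst _ _ ≫ m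
    let q' : T ⊗ N.N ⟶ N.N := fst _ _ ≫ q
    have key : lift (N.sub m' (N.P (snd _ _))) (N.sub q' (N.P (snd _ _))) ≫ f =
        N.cond (snd _ _) (lift (N.sub m' (snd _ _)) (N.sub q' (snd _ _)) ≫ f)
          (N.cond (N.sub m' (N.P (snd _ _))) (lift N.Z (N.sub q' (N.P (snd _ _))) ≫ f)
            (N.cond (N.sub q' (N.P (snd _ _))) (lift (N.sub m' (N.P (snd _ _))) N.Z ≫ f)
              (lift (N.sub m' (snd _ _)) (N.sub q' (snd _ _)) ≫ f ≫ h))) := by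
      refine N.hom_ext_cases (by simp [m', q', comp_lift_assoc]) ?_
      simpa [m', q', comp_lift_assoc] using
        split (N.sub (fst T N.N ≫ m) (snd _ _)) (N.sub (fst _ _ ≫ q) (snd _ _)) f s
    simpa [m', q', comp_lift_assoc] using congrArg (lift (𝟙 T) a ≫ ·) key
  have ez {T : C} (w : T ⟶ N.N) : lift N.Z w ≫ f₁ = lift N.Z w ≫ f₂ := by
    simpa [comp_lift_assoc] using congrArg (w ≫ ·) z
  have ez' {T : C} (w : T ⟶ N.N) : lift w N.Z ≫ f₁ = lift w N.Z ≫ f₂ := by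
    simpa [comp_lift_assoc] using congrArg (w ≫ ·) z'
  let m : (N.N ⊗ N.N) ⊗ N.N ⟶ N.N := fst _ _ ≫ fst _ _
  let q : (N.N ⊗ N.N) ⊗ N.N ⟶ N.N := fst _ _ ≫ snd _ _
  let a : (N.N ⊗ N.N) ⊗ N.N ⟶ N.N := N.sub m (snd _ _)
  have key : lift (N.sub m a) (N.sub q a) ≫ f₁ = lift (N.sub m a) (N.sub q a) ≫ f₂ := by
    let m' : (N.N ⊗ N.N) ⊗ (N.N ⊗ B) ⟶ N.N := fst _ _ ≫ fst _ _
    let q' : (N.N ⊗ N.N) ⊗ (N.N ⊗ B) ⟶ N.N := fst _ _ ≫ snd _ _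
    let a' : (N.N ⊗ N.N) ⊗ (N.N ⊗ B) ⟶ N.N := N.sub m' (snd _ _ ≫ fst _ _)
    let b : (N.N ⊗ N.N) ⊗ (N.N ⊗ B) ⟶ B := snd _ _ ≫ snd _ _
    refine N.hom_ext_ind (N.cond a' b
      (N.cond (N.sub m' (N.P a')) (lift N.Z (N.sub q' (N.P a')) ≫ f₁)
        (N.cond (N.sub q' (N.P a')) (lift (N.sub m' (N.P a')) N.Z ≫ f₁) (b ≫ h)))) ?_ ?_ ?_
    · simp [m, q, a, comp_lift_assoc, ez]
    · simpa [m, q, a, m', q', a', b, comp_lift_assoc] using step a m q f₁ s₁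
    · simpa [m, q, a, m', q', a', b, comp_lift_assoc, ez, ez'] using step a m q f₂ s₂
  -- at `j = m` the values are `f (m, q)`
  have := congrArg (lift (𝟙 _) (fst _ _) ≫ ·) key
  simpa [m, q, a, comp_lift_assoc] using this

/-- Both sides are the maximum of `m` and `n`. -/
lemma add_sub_comm (m n : T ⟶ N.N) : N.add m (N.sub n m) = N.add n (N.sub m n) := by
  have key : N.add (fst N.N N.N) (N.sub (snd _ _) (fst _ _)) =
      N.add (snd N.N N.N) (N.sub (fst _ _) (snd _ _)) :=
    N.hom_ext_double (N.S (𝟙 _)) (by simp) (by simp) (by simp [S_add, -sub_S])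
      (by simp [S_add, -sub_S])
  simpa using congrArg (lift m n ≫ ·) key

lemma add_sub_of_le {m n : T ⟶ N.N} (h : N.sub m n = N.Z) : N.add m (N.sub n m) = n := by
  rw [add_sub_comm, h, add_Z]

lemma sub_sub_of_le {m n : T ⟶ N.N} (h : N.sub m n = N.Z) : N.sub n (N.sub n m) = m := by
  have e := add_sub_cancel_right m (N.sub n m)
  rwa [add_sub_of_le h] at e

lemma S_sub_of_le {m n : T ⟶ N.N} (h : N.sub m n = N.Z) :
    N.sub (N.S n) m = N.S (N.sub n m) := by
  have e := add_sub_cancel_left m (N.S (N.sub n m))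
  rwa [add_S, add_sub_of_le h] at e

end NatObj

/-! ### Lists, on generalized elements -/

namespace ListObj

variable {X Y : C} (l : ListObj X) (l' : ListObj Y) (N : NatObj C) {A B T U : C}

/-- The empty list as a generalized element at stage `T`. -/
def empty : T ⟶ l.L := toUnit T ≫ l.nil

/-- The list `x :: t`, for generalized elements `x` and `t`. -/
def push (x : T ⟶ X) (t : T ⟶ l.L) : T ⟶ l.L := lift x t ≫ l.cons

/-- The truncation of a generalized element of `L(X)`. -/
noncomputable def tl (t : T ⟶ l.L) : T ⟶ l.L := t ≫ l.tr

/-- The zeroth element, with default `x`, of a generalized element `t` of `L(X)`. -/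
noncomputable def hd (x : T ⟶ X) (t : T ⟶ l.L) : T ⟶ X := lift x t ≫ l.zerothDef

/-- The length of a generalized element of `L(X)`. -/
noncomputable def ln (t : T ⟶ l.L) : T ⟶ N.N := t ≫ l.len N

/-- The `n`-fold truncation of `t`, for generalized elements `n` of `N` and `t` of `L(X)`. -/
noncomputable def drop (n : T ⟶ N.N) (t : T ⟶ l.L) : T ⟶ l.L := lift n t ≫ l.tail N

variable {l l' N}

@[simp] lemma comp_empty (t : U ⟶ T) : t ≫ (l.empty : T ⟶ l.L) = l.empty := by simp [empty]

@[simp] lemma comp_push (t : U ⟶ T) (x : T ⟶ X) (r : T ⟶ l.L) :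
    t ≫ l.push x r = l.push (t ≫ x) (t ≫ r) := by
  simp [push, comp_lift_assoc]

@[simp] lemma comp_tl (t : U ⟶ T) (r : T ⟶ l.L) : t ≫ l.tl r = l.tl (t ≫ r) := by simp [tl]

@[simp] lemma comp_hd (t : U ⟶ T) (x : T ⟶ X) (r : T ⟶ l.L) :
    t ≫ l.hd x r = l.hd (t ≫ x) (t ≫ r) := by
  simp [hd, comp_lift_assoc]

@[simp] lemma comp_ln (t : U ⟶ T) (r : T ⟶ l.L) : t ≫ l.ln N r = l.ln N (t ≫ r) := by
  simp [ln]

@[simp] lemma comp_drop (t : U ⟶ T) (n : T ⟶ N.N) (r : T ⟶ l.L) :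
    t ≫ l.drop N n r = l.drop N (t ≫ n) (t ≫ r) := by
  simp [drop, comp_lift_assoc]

@[simp] lemma tl_empty : l.tl (l.empty : T ⟶ l.L) = l.empty := by simp [tl, empty]

@[simp] lemma tl_push (x : T ⟶ X) (t : T ⟶ l.L) : l.tl (l.push x t) = t := by simp [tl, push]

@[simp] lemma hd_empty (x : T ⟶ X) : l.hd x l.empty = x := by
  simp [hd, empty, zerothDef, fold_nil]

@[simp] lemma hd_push (x y : T ⟶ X) (t : T ⟶ l.L) : l.hd x (l.push y t) = y := by
  simp [hd, push, zerothDef, fold_cons]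

@[simp] lemma ln_empty : l.ln N (l.empty : T ⟶ l.L) = N.Z := by simp [ln, empty, len, NatObj.Z]

@[simp] lemma ln_push (x : T ⟶ X) (t : T ⟶ l.L) : l.ln N (l.push x t) = N.S (l.ln N t) := by
  simp [ln, push, len, NatObj.S]

@[simp] lemma drop_Z (t : T ⟶ l.L) : l.drop N N.Z t = t := by
  simp [drop, tail, comp_lift_assoc, NatObj.Z, NatObj.recur_zero]

@[simp] lemma drop_S (n : T ⟶ N.N) (t : T ⟶ l.L) :
    l.drop N (N.S n) t = l.tl (l.drop N n t) := by
  simp [drop, tail, comp_lift_assoc, NatObj.S, NatObj.recur_succ, tl]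

lemma lift_nthDef (x : T ⟶ X) (n : T ⟶ N.N) (t : T ⟶ l.L) :
    lift x (lift n t) ≫ l.nthDef N = l.hd x (l.drop N n t) := by
  simp [nthDef, hd, drop]

@[simp] lemma empty_map (f : X ⟶ Y) : (l.empty : T ⟶ l.L) ≫ l.map l' f = l'.empty := by
  simp [empty, map]

@[simp] lemma push_map (f : X ⟶ Y) (x : T ⟶ X) (t : T ⟶ l.L) :
    l.push x t ≫ l.map l' f = l'.push (x ≫ f) (t ≫ l.map l' f) := by
  simp [push, map]

/-- Case distinction: two arrows out of `A × L(X)` agree if they agree at the empty list and at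
lists of the form `x :: t`. Since list recursion gives no access to the remaining list, the
recursion is run on triples `(f (a, t), a, t)`. -/
lemma hom_ext_cases {f₁ f₂ : A ⊗ l.L ⟶ B}
    (z : lift (𝟙 A) l.empty ≫ f₁ = lift (𝟙 A) l.empty ≫ f₂)
    (s : lift (fst A (X ⊗ l.L)) (l.push (snd _ _ ≫ fst _ _) (snd _ _ ≫ snd _ _)) ≫ f₁ =
      lift (fst A (X ⊗ l.L)) (l.push (snd _ _ ≫ fst _ _) (snd _ _ ≫ snd _ _)) ≫ f₂) :
    f₁ = f₂ := by
  have e : (A ◁ l.cons) =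
      lift (fst A (X ⊗ l.L)) (l.push (snd _ _ ≫ fst _ _) (snd _ _ ≫ snd _ _)) := by
    ext <;> simp [push]
  let c : X ⊗ (B ⊗ (A ⊗ l.L)) ⟶ A ⊗ l.L :=
    lift (snd _ _ ≫ snd _ _ ≫ fst _ _) (l.push (fst _ _) (snd _ _ ≫ snd _ _ ≫ snd _ _))
  have key : lift f₁ (𝟙 _) = lift f₂ (𝟙 _) := by
    refine l.hom_ext_fold _ (lift (c ≫ f₁) c) rfl ?_ ?_ ?_
    · rw [e]
      ext <;> simp [c, comp_lift_assoc]
    · have z' := z.symm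
      simp only [empty] at z'
      simp only [comp_lift, z']
    · rw [e]
      ext <;> simp [c, comp_lift_assoc, s]
  simpa using congrArg (· ≫ fst _ _) key

lemma ln_tl (t : T ⟶ l.L) : l.ln N (l.tl t) = N.P (l.ln N t) := by
  have key : l.ln N (l.tl (snd (𝟙_ C) l.L)) = N.P (l.ln N (snd _ _)) :=
    hom_ext_cases (by simp) (by simp)
  simpa using congrArg (lift (toUnit T) t ≫ ·) key

@[simp] lemma ln_drop (n : T ⟶ N.N) (t : T ⟶ l.L) :
    l.ln N (l.drop N n t) = N.sub (l.ln N t) n := by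
  have key : l.ln N (l.drop N (snd _ _) (fst l.L N.N)) = N.sub (l.ln N (fst _ _)) (snd _ _) :=
    N.hom_ext_ind (N.P (snd _ _ ≫ snd _ _)) (by simp) (by simp [ln_tl]) (by simp)
  simpa using congrArg (lift t n ≫ ·) key

/-- A list is empty or has a leading element, according to its length; `x` only serves
as the default value of `zerothDef`. -/
lemma eq_cond (x : T ⟶ X) (t : T ⟶ l.L) :
    N.cond (l.ln N t) l.empty (l.push (l.hd x t) (l.tl t)) = t := by
  have key : N.cond (l.ln N (snd X l.L)) l.empty (l.push (l.hd (fst _ _) (snd _ _))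
      (l.tl (snd _ _))) = snd X l.L :=
    hom_ext_cases (by simp) (by simp)
  simpa using congrArg (lift x t ≫ ·) key

lemma tl_map (f : X ⟶ Y) (t : T ⟶ l.L) :
    l.tl t ≫ l.map l' f = l'.tl (t ≫ l.map l' f) := by
  have key : l.tl (snd (𝟙_ C) l.L) ≫ l.map l' f = l'.tl (snd _ _ ≫ l.map l' f) :=
    hom_ext_cases (by simp [← Category.assoc]) (by simp [← Category.assoc])
  simpa [← Category.assoc] using congrArg (lift (toUnit T) t ≫ ·) key

lemma hd_map (f : X ⟶ Y) (x : T ⟶ X) (t : T ⟶ l.L) :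
    l'.hd (x ≫ f) (t ≫ l.map l' f) = l.hd x t ≫ f := by
  have key : l'.hd (fst X l.L ≫ f) (snd _ _ ≫ l.map l' f) = l.hd (fst _ _) (snd _ _) ≫ f :=
    hom_ext_cases (by simp [← Category.assoc]) (by simp [← Category.assoc])
  simpa [← Category.assoc] using congrArg (lift x t ≫ ·) key

lemma drop_map (f : X ⟶ Y) (n : T ⟶ N.N) (t : T ⟶ l.L) :
    l.drop N n t ≫ l.map l' f = l'.drop N n (t ≫ l.map l' f) := by
  have key : l.drop N (snd _ _) (fst l.L N.N) ≫ l.map l' f =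
      l'.drop N (snd _ _) (fst _ _ ≫ l.map l' f) :=
    N.hom_ext_ind (l'.tl (snd _ _ ≫ snd _ _)) (by simp [← Category.assoc])
      (by simp [← Category.assoc, tl_map]) (by simp [← Category.assoc])
  simpa [← Category.assoc] using congrArg (lift t n ≫ ·) key

/-! ### Lists are determined by their length and their elements -/

/-- One step of the reconstruction of a list `t` of length `n` from its truncations: the
`P k`-th truncation in terms of the `k`-th one. The outer case distinction handles `k = 0`, the
inner one the truncations that are already empty. -/
lemma drop_P_eq (x : T ⟶ X) (n k : T ⟶ N.N) (t : T ⟶ l.L) (ht : l.ln N t = n) :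
    l.drop N (N.P k) t = N.cond k (l.drop N k t) (N.cond (N.sub n (N.P k)) l.empty
      (l.push (l.hd x (l.drop N (N.P k) t)) (l.drop N k t))) := by
  subst ht
  have key : l.drop N (N.P (snd T N.N)) (fst _ _ ≫ t) =
      N.cond (snd T N.N) (l.drop N (snd T N.N) (fst _ _ ≫ t))
        (N.cond (N.sub (l.ln N (fst _ _ ≫ t)) (N.P (snd T N.N))) l.empty
          (l.push (l.hd (fst _ _ ≫ x) (l.drop N (N.P (snd T N.N)) (fst _ _ ≫ t)))
            (l.drop N (snd T N.N) (fst _ _ ≫ t)))) := by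
    refine N.hom_ext_cases (by simp) ?_
    simpa using (eq_cond (N := N) (fst _ _ ≫ x) (l.drop N (snd T N.N) (fst _ _ ≫ t))).symm
  simpa using congrArg (lift (𝟙 T) k ≫ ·) key

/-- Two lists of length `s q` agree if their elements of index `q ∸ k` agree for all `k`. Both
families `tail (s q ∸ k, t)`, which run from the empty list at `k = 0` to `t` at `k = s q`,
satisfy the same recursion in `k`. -/
lemma eq_of_hd_drop_eq {x : T ⟶ X} {q : T ⟶ N.N} {t t' : T ⟶ l.L}
    (ht : l.ln N t = N.S q) (ht' : l.ln N t' = N.S q)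
    (h : l.hd (fst _ _ ≫ x) (l.drop N (N.sub (fst _ _ ≫ q) (snd T N.N)) (fst _ _ ≫ t)) =
      l.hd (fst _ _ ≫ x) (l.drop N (N.sub (fst _ _ ≫ q) (snd T N.N)) (fst _ _ ≫ t'))) :
    t = t' := by
  let Q : T ⊗ N.N ⟶ N.N := fst _ _ ≫ q
  have key : l.drop N (N.sub (N.S Q) (snd _ _)) (fst _ _ ≫ t) =
      l.drop N (N.sub (N.S Q) (snd _ _)) (fst _ _ ≫ t') := by
    let q' : T ⊗ (N.N ⊗ l.L) ⟶ N.N := fst _ _ ≫ q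
    let k : T ⊗ (N.N ⊗ l.L) ⟶ N.N := snd _ _ ≫ fst _ _
    let r : T ⊗ (N.N ⊗ l.L) ⟶ l.L := snd _ _ ≫ snd _ _
    let e : T ⊗ N.N ⟶ X :=
      l.hd (fst _ _ ≫ x) (l.drop N (N.sub (fst _ _ ≫ q) (snd T N.N)) (fst _ _ ≫ t))
    have start (r : T ⟶ l.L) (hr : l.ln N r = N.S q) : l.drop N (N.S q) r = l.empty := by
      rw [← eq_cond (N := N) x (l.drop N (N.S q) r), ln_drop, hr, NatObj.sub_self, NatObj.cond_Z]
    -- the step `r ↦ e(k) :: r`, made total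
    refine N.hom_ext_ind (N.cond (N.sub (N.S q') k) r
      (N.cond (N.sub (N.S q') (N.sub q' k)) l.empty
        (l.push (lift (fst _ _) k ≫ e) r))) ?_ ?_ ?_
    · simpa [Q, -drop_S] using (start t ht).trans (start t' ht').symm
    · have := drop_P_eq (N := N) (fst _ _ ≫ x) (N.S Q) (N.sub (N.S Q) (snd _ _)) (fst _ _ ≫ t)
        (by rw [← comp_ln, ht, NatObj.comp_S])
      rw [← NatObj.sub_S, NatObj.S_sub_S] at this
      simpa [Q, q', k, r, e, comp_lift_assoc, -NatObj.sub_S] using this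
    · have := drop_P_eq (N := N) (fst _ _ ≫ x) (N.S Q) (N.sub (N.S Q) (snd _ _)) (fst _ _ ≫ t')
        (by rw [← comp_ln, ht', NatObj.comp_S])
      rw [← NatObj.sub_S, NatObj.S_sub_S, ← h] at this
      simpa [Q, q', k, r, e, comp_lift_assoc, -NatObj.sub_S] using this
  simpa [Q, -NatObj.sub_S] using congrArg (lift (𝟙 _) (N.S q) ≫ ·) key

/-! ### Tabulation -/

variable (l N) in
/-- The list `[g(k - 1), …, g(0)]`, for a sequence `g : T × N ⟶ X` and `k : N`. -/
noncomputable def tabulate (g : T ⊗ N.N ⟶ X) : T ⊗ N.N ⟶ l.L :=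
  N.recur l.empty (l.push (lift (fst _ _) (snd _ _ ≫ fst _ _) ≫ g) (snd _ _ ≫ snd _ _))

lemma tabulate_Z (g : T ⊗ N.N ⟶ X) (t : U ⟶ T) :
    lift t N.Z ≫ l.tabulate N g = l.empty := by
  simp [tabulate, NatObj.Z, NatObj.recur_zero]

lemma tabulate_S (g : T ⊗ N.N ⟶ X) (t : U ⟶ T) (k : U ⟶ N.N) :
    lift t (N.S k) ≫ l.tabulate N g = l.push (lift t k ≫ g) (lift t k ≫ l.tabulate N g) := by
  simp [tabulate, NatObj.S, NatObj.recur_succ, comp_lift_assoc]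

lemma ln_tabulate (g : T ⊗ N.N ⟶ X) (t : U ⟶ T) (k : U ⟶ N.N) :
    l.ln N (lift t k ≫ l.tabulate N g) = k := by
  have key : l.ln N (lift (fst _ _) (snd _ _) ≫ l.tabulate N g) = snd T N.N :=
    N.hom_ext_ind (N.S (snd _ _ ≫ snd _ _)) (by simp [tabulate_Z])
      (by simp [tabulate_S]) (by simp)
  simpa [comp_lift_assoc] using congrArg (lift t k ≫ ·) key

lemma tl_tabulate (g : T ⊗ N.N ⟶ X) (t : U ⟶ T) (k : U ⟶ N.N) :
    l.tl (lift t k ≫ l.tabulate N g) = lift t (N.P k) ≫ l.tabulate N g := by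
  have key : l.tl (lift (fst _ _) (snd _ _) ≫ l.tabulate N g) =
      lift (fst _ _) (N.P (snd _ _)) ≫ l.tabulate N g :=
    N.hom_ext_cases (by simp [tabulate_Z, comp_lift_assoc])
      (by simp [tabulate_S, comp_lift_assoc])
  simpa [comp_lift_assoc] using congrArg (lift t k ≫ ·) key

lemma drop_tabulate (g : T ⊗ N.N ⟶ X) (t : U ⟶ T) (m k : U ⟶ N.N) :
    l.drop N m (lift t k ≫ l.tabulate N g) = lift t (N.sub k m) ≫ l.tabulate N g := by
  let t' : U ⊗ N.N ⟶ T := fst _ _ ≫ t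
  let k' : U ⊗ N.N ⟶ N.N := fst _ _ ≫ k
  have key : l.drop N (snd _ _) (lift t' k' ≫ l.tabulate N g) =
      lift t' (N.sub k' (snd _ _)) ≫ l.tabulate N g :=
    N.hom_ext_ind (l.tl (snd _ _ ≫ snd _ _)) (by simp [t', k', comp_lift_assoc])
      (by simp [t', k', comp_lift_assoc]) (by simp [t', k', comp_lift_assoc, tl_tabulate])
  simpa [t', k', comp_lift_assoc] using congrArg (lift (𝟙 _) m ≫ ·) key

/-! ### Decomposition of lists -/

lemma push_inj_left {x x' : T ⟶ X} {t t' : T ⟶ l.L} (h : l.push x t = l.push x' t') :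
    x = x' := by
  simpa using congrArg (l.hd x) h

lemma eq_empty_of_ln (h : IsPullback l.nil (toUnit (𝟙_ C)) (l.len N) N.zero) {t : T ⟶ l.L}
    (ht : l.ln N t = N.Z) : t = l.empty := by
  rw [← h.lift_fst t (toUnit T) ht, empty]
  congr 1
  exact toUnit_unique _ _

lemma exists_eq_push_of_ln (h : IsPullback l.cons (snd X l.L ≫ l.len N) (l.len N) N.succ)
    {t : T ⟶ l.L} {n : T ⟶ N.N} (ht : l.ln N t = N.S n) : ∃ x r, t = l.push x r := by
  have e := h.lift_fst t n ht
  refine ⟨h.lift t n ht ≫ fst _ _, h.lift t n ht ≫ snd _ _, ?_⟩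
  rw [push, ← comp_lift, lift_fst_snd, Category.comp_id]
  exact e.symm

end ListObj

lemma NatObj.lt_S_iff {N : NatObj C} {T : C} {m n : T ⟶ N.N} :
    N.Lt m (N.S n) ↔ N.sub m n = N.Z := by
  rw [← S_sub_S]; rfl

variable [HasFiniteLimits C]

/-! ### Generalized elements of `{(m, a) : m < p a}` -/

namespace NatObj

variable {N : NatObj C} {A T U : C} {p : A ⟶ N.N}

/-- The arrow `(m, a) ↦ m` on `E ×_N A = {(m, a) : m < p a}`. -/
noncomputable def index (p : A ⟶ N.N) : pullback p N.π₂E ⟶ N.N :=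
  pullback.snd p N.π₂E ≫ N.ιE ≫ fst N.N N.N

lemma fst_comp_eq (p : A ⟶ N.N) : pullback.fst p N.π₂E ≫ p =
    pullback.snd p N.π₂E ≫ N.ιE ≫ snd N.N N.N := pullback.condition

lemma index_lt (p : A ⟶ N.N) : N.Lt (index p) (pullback.fst p N.π₂E ≫ p) := by
  have h := congrArg (fun t => pullback.snd p N.π₂E ≫ t) N.lt_E
  rw [NatObj.Lt, index, pullback.condition]
  simpa [← Category.assoc, comp_lift] using h

/-- A generalized element of `{(m, a) : m < p a}` is determined by `m` and `a`. -/
lemma hom_ext_below {f₁ f₂ : T ⟶ pullback p N.π₂E}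
    (h : f₁ ≫ pullback.fst _ _ = f₂ ≫ pullback.fst _ _) (h' : f₁ ≫ index p = f₂ ≫ index p) :
    f₁ = f₂ := by
  have : Mono N.ιE := equalizer.ι_mono
  refine pullback.hom_ext h ?_
  rw [← cancel_mono N.ιE]
  ext
  · simpa [index] using h'
  · simpa [fst_comp_eq] using congrArg (· ≫ p) h

/-- The generalized element `(m, n)` of `E`. -/
noncomputable def pairE (m n : T ⟶ N.N) (h : N.Lt m n) : T ⟶ N.E :=
  equalizer.lift (lift m n) (by simpa [Lt, comp_lift_assoc] using h)

lemma pairE_ιE (m n : T ⟶ N.N) (h : N.Lt m n) : pairE m n h ≫ N.ιE = lift m n :=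
  equalizer.lift_ι _ _

variable (p) in
/-- The generalized element `(m, a)` of `{(m, a) : m < p a}`. -/
noncomputable def point (m : T ⟶ N.N) (a : T ⟶ A) (h : N.Lt m (a ≫ p)) :
    T ⟶ pullback p N.π₂E :=
  pullback.lift a (pairE m (a ≫ p) h) (by rw [π₂E, ← Category.assoc, pairE_ιE, lift_snd])

variable {m : T ⟶ N.N} {a : T ⟶ A} (h : N.Lt m (a ≫ p))

@[simp] lemma point_fst : point p m a h ≫ pullback.fst _ _ = a :=
  pullback.lift_fst _ _ _

@[simp] lemma point_fst_assoc {B : C} (f : A ⟶ B) :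
    point p m a h ≫ pullback.fst _ _ ≫ f = a ≫ f :=
  pullback.lift_fst_assoc _ _ _ _

@[simp] lemma point_index : point p m a h ≫ index p = m := by
  rw [point, index, pullback.lift_snd_assoc, ← Category.assoc, pairE_ιE, lift_fst]

lemma comp_point (t : U ⟶ T) : t ≫ point p m a h = point p (t ≫ m) (t ≫ a)
    (by simpa [Lt, comp_lift_assoc] using congrArg (t ≫ ·) h) :=
  hom_ext_below (by simp) (by simp)

/-- The pullbacks of `0` and `s` along `p : A ⟶ N` exhibit `A` as a coproduct. -/
lemma UniversalCoproduct.nonempty_isColimit (h₂ : N.UniversalCoproduct) (p : A ⟶ N.N) :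
    Nonempty (IsColimit (BinaryCofan.mk (pullback.fst p N.zero) (pullback.fst p N.succ))) := by
  refine h₂ (BinaryCofan.mk (pullback.fst p N.zero) (pullback.fst p N.succ))
    (mapPair (pullback.snd p N.zero) (pullback.snd p N.succ)) p ?_ (.of_discrete _) ?_
  · ext ⟨⟨⟩⟩
    · exact pullback.condition.symm
    · exact pullback.condition.symm
  · rintro ⟨⟨⟩⟩
    · exact IsPullback.of_hasPullback _ _
    · exact IsPullback.of_hasPullback _ _

lemma fst_zero_comp (p : A ⟶ N.N) : pullback.fst p N.zero ≫ p = N.Z := by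
  rw [pullback.condition, Z]
  congr 1
  exact toUnit_unique _ _

lemma fst_succ_comp (p : A ⟶ N.N) :
    pullback.fst p N.succ ≫ p = N.S (pullback.snd p N.succ) :=
  pullback.condition

lemma UniversalCoproduct.hom_ext (h₂ : N.UniversalCoproduct) (p : A ⟶ N.N) {B : C}
    {f f' : A ⟶ B} (h₀ : pullback.fst p N.zero ≫ f = pullback.fst p N.zero ≫ f')
    (h₁ : pullback.fst p N.succ ≫ f = pullback.fst p N.succ ≫ f') : f = f' :=
  let ⟨hc⟩ := h₂.nonempty_isColimit p
  BinaryCofan.IsColimit.hom_ext hc h₀ h₁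

lemma UniversalCoproduct.exists_desc (h₂ : N.UniversalCoproduct) (p : A ⟶ N.N) {B : C}
    (f₀ : pullback p N.zero ⟶ B) (f₁ : pullback p N.succ ⟶ B) :
    ∃ f : A ⟶ B, pullback.fst p N.zero ≫ f = f₀ ∧ pullback.fst p N.succ ≫ f = f₁ :=
  let ⟨hc⟩ := h₂.nonempty_isColimit p
  let ⟨f, hf⟩ := BinaryCofan.IsColimit.desc' hc f₀ f₁
  ⟨f, hf⟩

end NatObj

/-! ### Families of elements below a length correspond to lists -/

variable {L : ∀ X : C, ListObj X} {N : NatObj C} (h₁ : LengthSquaresPullback L N) {A T X Y : C}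

/-- The default value is the leading element, in any context where one is exhibited. -/
lemma comp_dflt {t : T ⟶ EList L N X} {x : T ⟶ X} {r : T ⟶ (L X).L}
    (h : t ≫ lst L N X = (L X).push x r) : t ≫ dflt h₁ X = x := by
  refine ListObj.push_inj_left (l := L X) (t := t ≫ decomp h₁ X ≫ snd _ _) (t' := r) ?_
  have e : decomp h₁ X ≫ (L X).cons = lst L N X := (h₁ X).2.lift_fst _ _ _
  rw [← h, ← e, ListObj.push, dflt, ← comp_lift_assoc, ← comp_lift_assoc, lift_fst_snd]
  simp

lemma lst_eq_push : ∃ r, lst L N X = (L X).push (dflt h₁ X) r := by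
  refine ⟨decomp h₁ X ≫ snd _ _, ?_⟩
  have e : decomp h₁ X ≫ (L X).cons = lst L N X := (h₁ X).2.lift_fst _ _ _
  rw [← e, ListObj.push, dflt, ← comp_lift, lift_fst_snd, Category.comp_id]

lemma comp_nth {t : T ⟶ EList L N X} {x : T ⟶ X} {r : T ⟶ (L X).L}
    (h : t ≫ lst L N X = (L X).push x r) :
    t ≫ nth h₁ X = (L X).hd x ((L X).drop N (t ≫ idx L N X) (t ≫ lst L N X)) := by
  rw [nth, comp_lift_assoc, comp_lift, comp_dflt h₁ h, ListObj.lift_nthDef]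

/-- For `f : A ⟶ L(X)` of length `p`, the family of its elements: `(m, a) ↦ nth (m, f a)`. -/
noncomputable def elements {p : A ⟶ N.N} (f : A ⟶ (L X).L) (hf : f ≫ (L X).len N = p) :
    pullback p N.π₂E ⟶ X :=
  pullback.lift (pullback.fst _ _ ≫ f) (pullback.snd _ _)
    (by rw [Category.assoc, hf, pullback.condition]) ≫ nth h₁ X

lemma comp_elements {p : A ⟶ N.N} {f : A ⟶ (L X).L} (hf : f ≫ (L X).len N = p)
    (t : T ⟶ pullback p N.π₂E) {x : T ⟶ X} {r : T ⟶ (L X).L}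
    (h : t ≫ pullback.fst _ _ ≫ f = (L X).push x r) :
    t ≫ elements h₁ f hf =
      (L X).hd x ((L X).drop N (t ≫ NatObj.index p) (t ≫ pullback.fst _ _ ≫ f)) := by
  have hl : pullback.lift (pullback.fst p N.π₂E ≫ f) (pullback.snd _ _)
      (by rw [Category.assoc, hf, pullback.condition]) ≫ lst L N X = pullback.fst _ _ ≫ f :=
    pullback.lift_fst _ _ _
  have hi : pullback.lift (pullback.fst p N.π₂E ≫ f) (pullback.snd _ _)
      (by rw [Category.assoc, hf, pullback.condition]) ≫ idx L N X = NatObj.index p :=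
    pullback.lift_snd_assoc _ _ _ _
  rw [elements, ← Category.assoc, comp_nth h₁ (x := x) (r := r), Category.assoc, Category.assoc,
    hl, hi]
  rw [Category.assoc, hl, h]

/-- Where `p a = 0`, both lists are empty. Where `p a = s q`, both have a leading element; the two
agree, being the elements of index `0`, and so serve as a common default, and
`ListObj.eq_of_hd_drop_eq` applies. -/
lemma elements_injective (h₂ : N.UniversalCoproduct) {p : A ⟶ N.N} {f f' : A ⟶ (L X).L}
    (hf : f ≫ (L X).len N = p) (hf' : f' ≫ (L X).len N = p)
    (h : elements h₁ f hf = elements h₁ f' hf') : f = f' := by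
  refine h₂.hom_ext p ?_ ?_
  · have len0 (k : A ⟶ (L X).L) (hk : k ≫ (L X).len N = p) :
        (L X).ln N (pullback.fst p N.zero ≫ k) = N.Z := by
      rw [ListObj.ln, Category.assoc, hk, NatObj.fst_zero_comp]
    rw [ListObj.eq_empty_of_ln (h₁ X).1 (len0 f hf), ListObj.eq_empty_of_ln (h₁ X).1 (len0 f' hf')]
  · set i := pullback.fst p N.succ
    set q := pullback.snd p N.succ
    have hiq : i ≫ p = N.S q := NatObj.fst_succ_comp p
    have len1 (k : A ⟶ (L X).L) (hk : k ≫ (L X).len N = p) :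
        (L X).ln N (i ≫ k) = N.S q := by
      rw [ListObj.ln, Category.assoc, hk, hiq]
    obtain ⟨x, r, hx⟩ := ListObj.exists_eq_push_of_ln (h₁ X).2 (len1 f hf)
    obtain ⟨x', r', hx'⟩ := ListObj.exists_eq_push_of_ln (h₁ X).2 (len1 f' hf')
    -- the elements of index `0` are the leading elements `x` and `x'`
    have h0 : N.Lt N.Z (i ≫ p) := by rw [hiq, NatObj.lt_S_iff, NatObj.Z_sub]
    have exx : x = x' := by
      have : NatObj.point p N.Z i h0 ≫ elements h₁ f hf =
          NatObj.point p N.Z i h0 ≫ elements h₁ f' hf' := by rw [h]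
      rw [comp_elements h₁ hf _ (x := x) (r := r) (by simpa using hx),
        comp_elements h₁ hf' _ (x := x') (r := r') (by simpa using hx')] at this
      simpa [hx, hx'] using this
    subst exx
    refine ListObj.eq_of_hd_drop_eq (x := x) (len1 f hf) (len1 f' hf') ?_
    have hk : N.Lt (N.sub (fst _ _ ≫ q) (snd _ N.N)) ((fst _ _ ≫ i) ≫ p) := by
      rw [Category.assoc, hiq, NatObj.comp_S, NatObj.lt_S_iff, NatObj.sub_sub_self]
    have : NatObj.point p _ _ hk ≫ elements h₁ f hf =
        NatObj.point p _ _ hk ≫ elements h₁ f' hf' := by rw [h]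
    rw [comp_elements h₁ hf _ (x := fst _ _ ≫ x) (r := fst _ _ ≫ r) (by simp [hx]),
      comp_elements h₁ hf' _ (x := fst _ _ ≫ x) (r := fst _ _ ≫ r') (by simp [hx'])] at this
    simpa using this

/-- The list with given elements is empty where `p a = 0`. Where `p a = s q`, it is obtained by
tabulating `k ↦ g (q ∸ k, a)` for `k < s q`; the reversed index is below `s q` for every `k`, so
that the recursion is total although `g` is only defined below `p a`. -/
lemma elements_surjective (h₂ : N.UniversalCoproduct) {p : A ⟶ N.N}
    (g : pullback p N.π₂E ⟶ X) :
    ∃ (f : A ⟶ (L X).L) (hf : f ≫ (L X).len N = p), elements h₁ f hf = g := by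
  let i := pullback.fst p N.succ
  let q := pullback.snd p N.succ
  have hiq : i ≫ p = N.S q := NatObj.fst_succ_comp p
  have hk : N.Lt (N.sub (fst _ _ ≫ q) (snd _ N.N)) ((fst _ _ ≫ i) ≫ p) := by
    rw [Category.assoc, hiq, NatObj.comp_S, NatObj.lt_S_iff, NatObj.sub_sub_self]
  let g' := NatObj.point p _ _ hk ≫ g
  let f₁ := lift (𝟙 _) (N.S q) ≫ (L X).tabulate N g'
  obtain ⟨f, hf₀, hf₁⟩ := h₂.exists_desc p (L X).empty f₁
  have hf : f ≫ (L X).len N = p := by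
    refine h₂.hom_ext p ?_ ?_
    · rw [← Category.assoc, hf₀, NatObj.fst_zero_comp]
      exact ListObj.ln_empty
    · rw [← Category.assoc, hf₁, NatObj.fst_succ_comp]
      exact ListObj.ln_tabulate _ _ _
  refine ⟨f, hf, ?_⟩
  -- where `m < p a`, the element `a` lies in the summand on which `p` is a successor
  set a := pullback.fst p N.π₂E with ha
  set m := NatObj.index p with hm
  set n := N.P (a ≫ p) with hn
  have hap : a ≫ p = N.S n := by
    simpa [hn, NatObj.S, NatObj.P] using (NatObj.index_lt p).succ_pred_eq.symm
  have hmn : N.sub m n = N.Z := by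
    rw [← NatObj.lt_S_iff, ← hap]
    exact NatObj.index_lt p
  let b := pullback.lift a n hap
  have hbi : b ≫ i = a := pullback.lift_fst _ _ _
  have hbq : b ≫ q = n := pullback.lift_snd _ _ _
  have haf : a ≫ f = lift b (N.S n) ≫ (L X).tabulate N g' := by
    rw [← hbi, Category.assoc, hf₁]
    simp [f₁, comp_lift_assoc, hbq]
  have e := comp_elements h₁ hf (𝟙 _) (x := lift b n ≫ g')
    (r := lift b n ≫ (L X).tabulate N g') (by
      rw [Category.id_comp, ← ha, haf, ListObj.tabulate_S])
  simp only [Category.id_comp] at e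
  rw [e, ← ha, haf, ListObj.drop_tabulate, NatObj.S_sub_of_le hmn, ListObj.tabulate_S,
    ListObj.hd_push, ← Category.assoc, NatObj.comp_point]
  conv_rhs => rw [← Category.id_comp g]
  congr 1
  refine NatObj.hom_ext_below ?_ ?_
  · rw [NatObj.point_fst, Category.id_comp, ← ha]
    simp [hbi]
  · rw [NatObj.point_index, Category.id_comp, ← hm]
    simp [hbq, NatObj.sub_sub_of_le hmn]

/-- Naturality of `nth`, for any arrow `t` that represents `(m, ℓ) ↦ (m, L(k)(ℓ))`. -/
lemma comp_nth_of_map (k : X ⟶ Y) {t : EList L N X ⟶ EList L N Y}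
    (hl : t ≫ lst L N Y = lst L N X ≫ (L X).map (L Y) k) (hi : t ≫ idx L N Y = idx L N X) :
    t ≫ nth h₁ Y = nth h₁ X ≫ k := by
  obtain ⟨r, hr⟩ := lst_eq_push h₁ (X := X)
  have e : nth h₁ X = (L X).hd (dflt h₁ X) ((L X).drop N (idx L N X) (lst L N X)) :=
    ListObj.lift_nthDef _ _ _
  rw [comp_nth h₁ (x := dflt h₁ X ≫ k) (r := r ≫ (L X).map (L Y) k), e, hl, hi,
    ← ListObj.drop_map, ListObj.hd_map]
  rw [hl, hr, ListObj.push_map]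

/-- The arrow `nth_X`, with its domain written as the value of the composite functor at `X`. -/
noncomputable def counitApp (X : C) : (sigmaDelta N).obj ((listOver L N).obj X) ⟶ X := nth h₁ X

lemma counitApp_naturality (k : X ⟶ Y) :
    (sigmaDelta N).map ((listOver L N).map k) ≫ counitApp h₁ Y = counitApp h₁ X ≫ k :=
  comp_nth_of_map h₁ k (pullback.lift_fst _ _ _) (pullback.lift_snd_assoc _ _ _ _)

/-- The hom-set bijection of the adjunction. -/
noncomputable def homEquiv (h₂ : N.UniversalCoproduct) (A : Over N.N) (X : C) :
    (A ⟶ (listOver L N).obj X) ≃ ((sigmaDelta N).obj A ⟶ X) :=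
  Equiv.ofBijective (fun f => (sigmaDelta N).map f ≫ counitApp h₁ X) <| by
    constructor
    · intro f f' h
      exact Over.OverMorphism.ext (elements_injective h₁ h₂ (Over.w f) (Over.w f') h)
    · intro g
      obtain ⟨f, hf, e⟩ := elements_surjective h₁ h₂ (p := A.hom) g
      exact ⟨Over.homMk f hf, e⟩

lemma homEquiv_apply (h₂ : N.UniversalCoproduct) {A : Over N.N} {X : C}
    (f : A ⟶ (listOver L N).obj X) :
    homEquiv h₁ h₂ A X f = (sigmaDelta N).map f ≫ counitApp h₁ X := rfl

end ListPoly

theorem mainTheorem2 {C : Type u} [Category.{v} C] [CartesianMonoidalCategory C]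
    [HasFiniteLimits C] (L : ∀ X : C, ListPoly.ListObj X) (N : ListPoly.NatObj C)
    (h₁ : ListPoly.LengthSquaresPullback L N) (h₂ : N.UniversalCoproduct) :
    ∃ adj : ListPoly.sigmaDelta N ⊣ ListPoly.listOver L N,
      ∀ X : C, adj.counit.app X = ListPoly.nth h₁ X := by
  refine ⟨Adjunction.mkOfHomEquiv
    { homEquiv := fun A X => (ListPoly.homEquiv h₁ h₂ A X).symm
      homEquiv_naturality_left_symm := fun f g => ?_
      homEquiv_naturality_right := fun f k => ?_ }, fun X => ?_⟩
  · rw [Equiv.symm_symm, Equiv.symm_symm, ListPoly.homEquiv_apply, ListPoly.homEquiv_apply,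
      Functor.map_comp, Category.assoc]
  · rw [Equiv.symm_apply_eq]
    obtain ⟨g, rfl⟩ := (ListPoly.homEquiv h₁ h₂ _ _).surjective f
    rw [Equiv.symm_apply_apply, ListPoly.homEquiv_apply, ListPoly.homEquiv_apply,
      Functor.map_comp, Category.assoc, Category.assoc, ListPoly.counitApp_naturality]
  · rw [Adjunction.mkOfHomEquiv_counit_app, Equiv.symm_symm, ListPoly.homEquiv_apply,
      CategoryTheory.Functor.map_id, Category.id_comp]
    rfl
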